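/- Let $n\ge 1$ be an integer, let $-\infty\le a<b\le\infty$, and let $f:(a,b)\to\mathbb{R}$ be twice continuously differentiable. Suppose that $f$ is operator convex of order $n$ on $(a,b)$, i.e. \[ f(rA+(1-r)B)\le r f(A)+(1-r)f(B)\qquad\text{for all } r\in[0,1] \] and all complex Hermitian $n\times n$ matrices $A,B$ with spectra contained in $(a,b)$, where $f(A)$ is defined by the functional calculus and $X\le Y$ means that $Y-X$ is positive semidefinite. For $s_1,s_2,s_3\in(a,b)$ put \[ \Delta f(s_1,s_2)=\begin{cases}\dfrac{f(s_2)-f(s_1)}{s_2-s_1}, & s_1\neq s_2,\\[2mm] f'(s_1), & s_1=s_2,\end{cases} \qquad \Delta^2 f(s_1,s_2,s_3)=\begin{cases}\dfrac{\Delta f(s_3,s_1)-\Delta f(s_2,s_1)}{s_3-s_2}, & s_2\neq s_3,\\[2mm] \lim\limits_{s\to s_2}\Delta^2 f(s_1,s_2,s), & s_2=s_3.\end{cases} \] Then for all (not necessarily distinct) $t_1,\dots,t_n\in(a,b)$ the $n\times n$ matrix \[ [\Delta^2 f(t_i,t_j,t_1)]_{i,j=1}^n \] is positive semidefinite. -/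

import Mathlib

open Set Filter Topology
open scoped MatrixOrder ComplexOrder

noncomputable section

/-- The open interval `(a, b) ⊆ ℝ`, where the endpoints may be infinite. -/
def openInterval (a b : EReal) : Set ℝ := {x : ℝ | a < (x : EReal) ∧ (x : EReal) < b}

/-- `f` is operator convex of order `n` on `s`: `f (r A + (1 - r) B) ≤ r f(A) + (1 - r) f(B)` in the
Loewner order, for all `n × n` complex Hermitian matrices `A`, `B` with spectra in `s` and all
`r ∈ [0, 1]`. Here `cfc f A` is `f(A)`, the functional calculus of the Hermitian matrix `A`. -/
def OperatorConvexOfOrder (n : ℕ) (s : Set ℝ) (f : ℝ → ℝ) : Prop :=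
  ∀ A B : Matrix (Fin n) (Fin n) ℂ, A.IsHermitian → B.IsHermitian →
    spectrum ℝ A ⊆ s → spectrum ℝ B ⊆ s →
    ∀ r : ℝ, r ∈ Icc (0 : ℝ) 1 →
      cfc f (r • A + (1 - r) • B) ≤ r • cfc f A + (1 - r) • cfc f B

/-- The first divided difference `Δ f (t₁, t₂)`. -/
def dividedDiff (f : ℝ → ℝ) (t₁ t₂ : ℝ) : ℝ :=
  if t₁ = t₂ then deriv f t₁ else (f t₂ - f t₁) / (t₂ - t₁)

/-- The second divided difference
`Δ² f (t₁, t₂, t₃) = (Δ f (t₃, t₁) - Δ f (t₂, t₁)) / (t₃ - t₂)` for `t₂ ≠ t₃`, and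
`Δ² f (t₁, t₂, t₂) = lim_{t → t₂} Δ² f (t₁, t₂, t)`. The limit exists at all points of an
open interval on which `f` is twice continuously differentiable. -/
def secondDividedDiff (f : ℝ → ℝ) (t₁ t₂ t₃ : ℝ) : ℝ :=
  if t₂ = t₃ then
    limUnder (𝓝[≠] t₂) (fun t => (dividedDiff f t t₁ - dividedDiff f t₂ t₁) / (t - t₂))
  else (dividedDiff f t₃ t₁ - dividedDiff f t₂ t₁) / (t₃ - t₂)

/-- The `n × n` matrix `[Δ² f (t_i, t_j, c)]_{i,j}`, regarded as a complex matrix. -/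
def secondDividedDiffMatrix {n : ℕ} (f : ℝ → ℝ) (t : Fin n → ℝ) (c : ℝ) :
    Matrix (Fin n) (Fin n) ℂ :=
  Matrix.of fun i j => ((secondDividedDiff f (t i) (t j) c : ℝ) : ℂ)

end

open Polynomial Asymptotics

/-! Along a line diag(t) + hB, the h² coefficient of f has entries ∑ₖ Δ²f(tᵢ, tₖ, tⱼ) Bᵢₖ Bₖⱼ, and
midpoint convexity at ±h forces it to be positive semidefinite
(`OperatorConvexOfOrder.second_coeff_nonneg`). Since f is only C², it is traded for a polynomial p
with the same second-order jet at every tᵢ (`exists_polynomial_isLittleO_sq`): the divided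
differences at the tᵢ agree, the expansion of p is pure algebra, and f - p costs only o(h²) on the
spectrum. It remains to isolate one k. With B small (ε) off the diagonal in one row and column, and
the test vector scaled by 1/ε off that index, the unwanted terms are O(ε²)
(`crossMatrix_quadratic_form`); let ε → 0. -/

/-! ### Divided differences of polynomials -/

/-- `d₁` and `d₂` are the first and second divided differences of the polynomial `p`, extended
continuously to coinciding arguments, and they are the coefficients in the second order expansion
of `p` along lines through diagonal matrices. -/
structure Polynomial.HasDividedDiffs (p : ℝ[X]) (d₁ : ℝ → ℝ → ℝ) (d₂ : ℝ → ℝ → ℝ → ℝ) : Prop where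
  continuous_first : ∀ x, Continuous (d₁ x)
  continuous_second : ∀ x y, Continuous (d₂ x y)
  first_mul : ∀ x y, d₁ x y * (y - x) = p.eval y - p.eval x
  second_mul : ∀ x y z, d₂ x y z * (z - y) = d₁ z x - d₁ y x
  first_symm : ∀ x y, d₁ x y = d₁ y x
  second_swap_left : ∀ x y z, d₂ x y z = d₂ y x z
  second_swap_right : ∀ x y z, d₂ x y z = d₂ x z y
  expansion : ∀ (n : ℕ) (t : Fin n → ℝ) (B : Matrix (Fin n) (Fin n) ℂ),
    ∃ R : ℝ → Matrix (Fin n) (Fin n) ℂ, Continuous R ∧ ∀ h : ℝ,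
      aeval (Matrix.diagonal (fun i => (t i : ℂ)) + h • B) p =
        Matrix.diagonal (fun i => ((p.eval (t i) : ℝ) : ℂ))
        + h • Matrix.of (fun i j => (d₁ (t i) (t j) : ℂ) * B i j)
        + h ^ 2 • Matrix.of (fun i j => ∑ k, (d₂ (t i) (t k) (t j) : ℂ) * (B i k * B k j))
        + h ^ 3 • R h

theorem Polynomial.hasDividedDiffs_C (c : ℝ) : (C c).HasDividedDiffs 0 0 := by
  refine ⟨fun _ => continuous_const, fun _ _ => continuous_const, by simp, by simp, by simp,
    by simp, by simp, fun n t B => ⟨0, continuous_const, fun h => ?_⟩⟩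
  ext i j
  simp [Matrix.algebraMap_matrix_apply, Matrix.diagonal_apply]

theorem Polynomial.HasDividedDiffs.add {p q : ℝ[X]} {d₁ e₁ : ℝ → ℝ → ℝ} {d₂ e₂ : ℝ → ℝ → ℝ → ℝ}
    (hp : p.HasDividedDiffs d₁ d₂) (hq : q.HasDividedDiffs e₁ e₂) :
    (p + q).HasDividedDiffs (d₁ + e₁) (d₂ + e₂) where
  continuous_first x := (hp.continuous_first x).add (hq.continuous_first x)
  continuous_second x y := (hp.continuous_second x y).add (hq.continuous_second x y)
  first_mul x y := by
    have := hp.first_mul x y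
    have := hq.first_mul x y
    simp only [Pi.add_apply, eval_add]
    linarith
  second_mul x y z := by
    have := hp.second_mul x y z
    have := hq.second_mul x y z
    simp only [Pi.add_apply]
    linarith
  first_symm x y := by simp only [Pi.add_apply, hp.first_symm x y, hq.first_symm x y]
  second_swap_left x y z := by
    simp only [Pi.add_apply, hp.second_swap_left x y z, hq.second_swap_left x y z]
  second_swap_right x y z := by
    simp only [Pi.add_apply, hp.second_swap_right x y z, hq.second_swap_right x y z]
  expansion n t B := by
    obtain ⟨R, hR, hRp⟩ := hp.expansion n t B
    obtain ⟨S, hS, hSq⟩ := hq.expansion n t B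
    refine ⟨R + S, hR.add hS, fun h => ?_⟩
    rw [map_add, hRp, hSq]
    ext i j
    simp only [Matrix.add_apply, Matrix.smul_apply, Matrix.of_apply, Pi.add_apply, eval_add,
      Matrix.diagonal_apply, Complex.ofReal_add, add_mul, Finset.sum_add_distrib, smul_add]
    split_ifs <;> ring

/-- Leibniz rule. The new formulas are not visibly symmetric; symmetry is recovered from the
difference identities for p. -/
theorem Polynomial.HasDividedDiffs.X_mul {p : ℝ[X]} {d₁ : ℝ → ℝ → ℝ} {d₂ : ℝ → ℝ → ℝ → ℝ}
    (hp : p.HasDividedDiffs d₁ d₂) :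
    (X * p).HasDividedDiffs (fun x y => x * d₁ x y + p.eval y)
      (fun x y z => x * d₂ x y z + d₁ y z) where
  continuous_first x := (continuous_const.mul (hp.continuous_first x)).add p.continuous
  continuous_second x y :=
    (continuous_const.mul (hp.continuous_second x y)).add (hp.continuous_first y)
  first_mul x y := by
    simp only [eval_mul, eval_X]
    linear_combination x * hp.first_mul x y
  second_mul x y z := by
    linear_combination x * hp.second_mul x y z + hp.first_mul y z
      + hp.first_mul z x - hp.first_mul y x
  first_symm x y := by
    linear_combination x * hp.first_symm x y + hp.first_mul y x
  second_swap_left x y z := by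
    linear_combination x * hp.second_swap_left x y z + hp.second_mul z y x
      - (y - x) * (hp.second_swap_right y x z) - (y - x) * (hp.second_swap_left y z x)
  second_swap_right x y z := by
    linear_combination x * hp.second_swap_right x y z + hp.first_symm y z
  expansion n t B := by
    obtain ⟨R, hR, hRp⟩ := hp.expansion n t B
    refine ⟨fun h => Matrix.diagonal (fun i => (t i : ℂ)) * R h
      + B * Matrix.of (fun i j => ∑ k, (d₂ (t i) (t k) (t j) : ℂ) * (B i k * B k j))
      + h • (B * R h), by fun_prop, fun h => ?_⟩
    rw [map_mul, aeval_X, hRp]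
    have h0 : Matrix.diagonal (fun i => (((X * p).eval (t i) : ℝ) : ℂ)) =
        Matrix.diagonal (fun i => (t i : ℂ)) * Matrix.diagonal (fun i => ((p.eval (t i) : ℝ) : ℂ)) := by
      simp [Matrix.diagonal_mul_diagonal]
    have h1 : Matrix.of (fun i j => ((t i * d₁ (t i) (t j) + p.eval (t j) : ℝ) : ℂ) * B i j) =
        Matrix.diagonal (fun i => (t i : ℂ)) * Matrix.of (fun i j => (d₁ (t i) (t j) : ℂ) * B i j)
        + B * Matrix.diagonal (fun i => ((p.eval (t i) : ℝ) : ℂ)) := by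
      ext i j
      simp only [Matrix.of_apply, Matrix.add_apply, Matrix.diagonal_mul, Matrix.mul_diagonal]
      push_cast
      ring
    have h2 : Matrix.of (fun i j => ∑ k, ((t i * d₂ (t i) (t k) (t j) + d₁ (t k) (t j) : ℝ) : ℂ)
          * (B i k * B k j)) =
        Matrix.diagonal (fun i => (t i : ℂ)) *
          Matrix.of (fun i j => ∑ k, (d₂ (t i) (t k) (t j) : ℂ) * (B i k * B k j))
        + B * Matrix.of (fun i j => (d₁ (t i) (t j) : ℂ) * B i j) := by
      ext i j
      rw [Matrix.add_apply, Matrix.diagonal_mul, Matrix.mul_apply]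
      simp only [Matrix.of_apply, Finset.mul_sum, ← Finset.sum_add_distrib]
      refine Finset.sum_congr rfl fun k _ => ?_
      push_cast
      ring
    rw [h0, h1, h2]
    simp only [add_mul, mul_add, smul_mul_assoc, mul_smul_comm]
    module

theorem Polynomial.exists_hasDividedDiffs (p : ℝ[X]) :
    ∃ d₁ d₂, p.HasDividedDiffs d₁ d₂ := by
  induction p using Polynomial.induction_on with
  | C a => exact ⟨_, _, hasDividedDiffs_C a⟩
  | add p q hp hq =>
    obtain ⟨_, _, hp⟩ := hp
    obtain ⟨_, _, hq⟩ := hq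
    exact ⟨_, _, hp.add hq⟩
  | monomial n a h =>
    obtain ⟨_, _, h⟩ := h
    rw [pow_succ, ← mul_assoc, mul_comm]
    exact ⟨_, _, h.X_mul⟩

theorem Polynomial.HasDividedDiffs.hasDerivAt {p : ℝ[X]} {d₁ : ℝ → ℝ → ℝ} {d₂ : ℝ → ℝ → ℝ → ℝ}
    (hp : p.HasDividedDiffs d₁ d₂) (x : ℝ) : HasDerivAt (fun y => p.eval y) (d₁ x x) x := by
  rw [hasDerivAt_iff_tendsto_slope]
  refine ((hp.continuous_first x).tendsto x |>.mono_left nhdsWithin_le_nhds).congr' ?_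
  filter_upwards [self_mem_nhdsWithin] with y hy
  rw [slope_def_field, ← hp.first_mul, mul_div_cancel_right₀ _ (sub_ne_zero.mpr hy)]

/-! ### Second-order contact and divided differences -/

/-- The neighbourhood is not punctured, so the bound holds at y = x, where its right side vanishes.
-/
theorem isLittleO_sq_apply_eq {f g : ℝ → ℝ} {x : ℝ}
    (h : (fun y => f y - g y) =o[𝓝 x] fun y => (y - x) ^ 2) : f x = g x := by
  have := (h.bound one_pos).self_of_nhds
  simpa [sub_eq_zero] using this

theorem isLittleO_sq_hasDerivAt {f g : ℝ → ℝ} {x g' : ℝ}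
    (h : (fun y => f y - g y) =o[𝓝 x] fun y => (y - x) ^ 2) (hg : HasDerivAt g g' x) :
    HasDerivAt f g' x := by
  have h0 : HasDerivAt (fun y => f y - g y) 0 x := by
    rw [hasDerivAt_iff_isLittleO]
    have h1 : (fun y => (y - x) ^ 2) =O[𝓝 x] fun y => y - x := by
      have : (fun y : ℝ => y - x) =O[𝓝 x] fun _ => (1 : ℝ) :=
        (show ContinuousAt (fun y : ℝ => y - x) x by fun_prop).isBigO_one ℝ
      simpa [sq] using this.mul (isBigO_refl (fun y : ℝ => y - x) _)
    simpa [isLittleO_sq_apply_eq h] using h.trans_isBigO h1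
  have := h0.add hg
  rw [zero_add] at this
  exact this.congr_of_eventuallyEq (.of_forall fun y => by simp)

theorem Polynomial.HasDividedDiffs.dividedDiff_eq {p : ℝ[X]} {d₁ : ℝ → ℝ → ℝ}
    {d₂ : ℝ → ℝ → ℝ → ℝ} (hp : p.HasDividedDiffs d₁ d₂) {f : ℝ → ℝ} {x y : ℝ}
    (hx : (fun s => f s - p.eval s) =o[𝓝 x] fun s => (s - x) ^ 2)
    (hy : (fun s => f s - p.eval s) =o[𝓝 y] fun s => (s - y) ^ 2) :
    dividedDiff f x y = d₁ x y := by
  unfold dividedDiff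
  split_ifs with h
  · subst h
    exact (isLittleO_sq_hasDerivAt hx (hp.hasDerivAt x)).deriv
  · rw [isLittleO_sq_apply_eq hx, isLittleO_sq_apply_eq hy, ← hp.first_mul,
      mul_div_cancel_right₀ _ (sub_ne_zero.mpr (Ne.symm h))]

theorem Polynomial.HasDividedDiffs.secondDividedDiff_eq {p : ℝ[X]} {d₁ : ℝ → ℝ → ℝ}
    {d₂ : ℝ → ℝ → ℝ → ℝ} (hp : p.HasDividedDiffs d₁ d₂) {f : ℝ → ℝ} {x y z : ℝ}
    (hx : (fun s => f s - p.eval s) =o[𝓝 x] fun s => (s - x) ^ 2)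
    (hy : (fun s => f s - p.eval s) =o[𝓝 y] fun s => (s - y) ^ 2)
    (hz : (fun s => f s - p.eval s) =o[𝓝 z] fun s => (s - z) ^ 2) :
    secondDividedDiff f x y z = d₂ x y z := by
  unfold secondDividedDiff
  split_ifs with h
  · subst h
    apply Tendsto.limUnder_eq
    have hne : ∀ᶠ s in 𝓝[≠] y, s ≠ x := by
      rcases eq_or_ne y x with rfl | hyx
      · exact self_mem_nhdsWithin
      · exact nhdsWithin_le_nhds (isOpen_ne.mem_nhds hyx)
    -- This is exactly the gap between the difference quotient of f and `d₂ x y s`; second-order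
    -- contact is what makes it vanish when x = y.
    have hrem : Tendsto (fun s => (f s - p.eval s) / ((s - x) * (s - y))) (𝓝[≠] y) (𝓝 0) := by
      apply IsLittleO.tendsto_div_nhds_zero
      refine (hy.mono nhdsWithin_le_nhds).trans_isBigO ?_
      simp only [sq]
      refine IsBigO.mul ?_ (isBigO_refl _ _)
      rcases eq_or_ne y x with rfl | hyx
      · exact isBigO_refl _ _
      · have h1 : (fun s : ℝ => s - y) =O[𝓝 y] fun _ => (1 : ℝ) :=
          (show ContinuousAt (fun s : ℝ => s - y) y by fun_prop).isBigO_one ℝ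
        have h2 : (fun _ => (1 : ℝ)) =O[𝓝 y] fun s : ℝ => s - x := by
          have hc : ContinuousAt (fun s : ℝ => s - x) y := by fun_prop
          exact (isBigO_const_left_iff_pos_le_norm one_ne_zero).mpr
            ⟨|y - x| / 2, by have := abs_pos.mpr (sub_ne_zero.mpr hyx); positivity, by
              have := hc.norm.eventually_const_le (u := |y - x| / 2) (by
                have := abs_pos.mpr (sub_ne_zero.mpr hyx)
                simp only [Real.norm_eq_abs]; linarith)
              exact this⟩
        exact (h1.trans h2).mono nhdsWithin_le_nhds
    have hlim : Tendsto (fun s => d₂ x y s) (𝓝[≠] y) (𝓝 (d₂ x y y)) :=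
      ((hp.continuous_second x y).tendsto y).mono_left nhdsWithin_le_nhds
    have := hlim.add hrem
    rw [add_zero] at this
    refine this.congr' ?_
    filter_upwards [hne, self_mem_nhdsWithin] with s hsx hsy
    have hsx' : s - x ≠ 0 := sub_ne_zero.mpr hsx
    have hsx'' : x - s ≠ 0 := sub_ne_zero.mpr hsx.symm
    have hsy' : s - y ≠ 0 := sub_ne_zero.mpr hsy
    rw [hp.dividedDiff_eq hy hx, dividedDiff, if_neg hsx, isLittleO_sq_apply_eq hx]
    have e1 := hp.first_mul s x
    have e2 := hp.second_mul x y s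
    have e3 : d₁ y x = d₁ s x - d₂ x y s * (s - y) := by linarith
    have e4 : p.eval x = p.eval s + d₁ s x * (x - s) := by linarith
    rw [e3, e4]
    field_simp
    ring
  · rw [hp.dividedDiff_eq hz hx, hp.dividedDiff_eq hy hx, ← hp.second_mul,
      mul_div_cancel_right₀ _ (sub_ne_zero.mpr (Ne.symm h))]

/-! ### Hermite interpolation -/

theorem isOpen_openInterval (a b : EReal) : IsOpen (openInterval a b) :=
  (isOpen_Ioo (a := a) (b := b)).preimage continuous_coe_real_ereal

theorem convex_openInterval (a b : EReal) : Convex ℝ (openInterval a b) := by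
  apply OrdConnected.convex
  exact ⟨fun x hx y hy z hz => ⟨hx.1.trans_le (EReal.coe_le_coe_iff.mpr hz.1),
    (EReal.coe_le_coe_iff.mpr hz.2).trans_lt hy.2⟩⟩

/-- Hermite interpolation to second order at finitely many points. -/
theorem exists_polynomial_isLittleO_sq {s : Set ℝ} (hs : IsOpen s) (hc : Convex ℝ s) {f : ℝ → ℝ}
    (hf : ContDiffOn ℝ 2 f s) (T : Finset ℝ) (hT : ↑T ⊆ s) :
    ∃ p : ℝ[X], ∀ x ∈ T, (fun y => f y - p.eval y) =o[𝓝 x] fun y => (y - x) ^ 2 := by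
  have taylor : ∀ x : T, ∃ q : ℝ[X],
      (fun y => f y - q.eval y) =o[𝓝 (x : ℝ)] fun y => (y - x) ^ 2 := by
    intro x
    have h := taylor_isLittleO (n := 2) hc (hT x.2) (by exact_mod_cast hf)
    rw [hs.nhdsWithin_eq (hT x.2)] at h
    refine ⟨C (f x) + C (iteratedDerivWithin 1 f s x) * (X - C (x : ℝ))
      + C (2⁻¹ * iteratedDerivWithin 2 f s x) * (X - C (x : ℝ)) ^ 2, h.congr_left fun y => ?_⟩
    simp only [taylor_within_apply, Finset.sum_range_succ, Finset.sum_range_zero]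
    simp [Nat.factorial]
    ring
  choose q hq using taylor
  -- Chinese remainder theorem for the coprime cubes (X - x)³: a multiple of the cube is o((y -
  -- x)²).
  obtain ⟨p, hp⟩ := Ideal.exists_forall_sub_mem_ideal
    (I := fun x : T => Ideal.span {(X - C (x : ℝ)) ^ 3}) (fun x y hxy => by
      rw [Function.onFun, Ideal.isCoprime_span_singleton_iff]
      exact (pairwise_coprime_X_sub_C Subtype.val_injective hxy).pow) q
  refine ⟨p, fun x hx => ?_⟩
  obtain ⟨r, hr⟩ := Ideal.mem_span_singleton.mp (hp ⟨x, hx⟩)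
  have h3 : (fun y => (y - x) ^ 3 * r.eval y) =o[𝓝 x] fun y => (y - x) ^ 2 := by
    have h4 : Tendsto (fun y => (y - x) * r.eval y) (𝓝 x) (𝓝 0) := by
      have : Continuous fun y => (y - x) * r.eval y := by fun_prop
      simpa using this.tendsto x
    have := ((isLittleO_one_iff ℝ).mpr h4).mul_isBigO
      (isBigO_refl (fun y : ℝ => (y - x) ^ 2) (𝓝 x))
    refine this.congr (fun y => by ring) (fun y => by ring)
  refine ((hq ⟨x, hx⟩).sub h3).congr_left fun y => ?_
  have := congrArg (eval y) hr
  simp only [eval_sub, eval_mul, eval_pow, eval_X, eval_C] at this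
  linarith

/-! ### Second-order coefficient along a line -/

/-- Gershgorin's theorem, with the diagonal shift h Bₖₖ absorbed into the radius. -/
theorem exists_abs_sub_le_of_mem_spectrum_diagonal_add {n : ℕ} (t : Fin n → ℝ)
    (B : Matrix (Fin n) (Fin n) ℂ) {h l : ℝ}
    (hl : l ∈ spectrum ℝ (Matrix.diagonal (fun i => (t i : ℂ)) + h • B)) :
    ∃ k, |l - t k| ≤ |h| * ∑ i, ∑ j, ‖B i j‖ := by
  rw [← spectrum.algebraMap_mem_iff ℂ, ← Matrix.spectrum_toLin',
    ← Module.End.hasEigenvalue_iff_mem_spectrum] at hl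
  obtain ⟨k, hk⟩ := eigenvalue_mem_ball hl
  refine ⟨k, ?_⟩
  have h1 : ∑ j ∈ Finset.univ.erase k, ‖(Matrix.diagonal (fun i => (t i : ℂ)) + h • B) k j‖ =
      ∑ j ∈ Finset.univ.erase k, |h| * ‖B k j‖ := by
    refine Finset.sum_congr rfl fun j hj => ?_
    simp [Matrix.diagonal_apply_ne' _ (Finset.ne_of_mem_erase hj)]
  rw [mem_closedBall_iff_norm, h1, ← Finset.mul_sum] at hk
  have h2 : ((l - t k : ℝ) : ℂ) = (algebraMap ℝ ℂ l
      - (Matrix.diagonal (fun i => (t i : ℂ)) + h • B) k k) + h • B k k := by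
    simp
    ring
  calc |l - t k| = ‖((l - t k : ℝ) : ℂ)‖ := by rw [Complex.norm_real, Real.norm_eq_abs]
    _ ≤ |h| * ∑ j ∈ Finset.univ.erase k, ‖B k j‖ + |h| * ‖B k k‖ := by
        rw [h2]
        refine (norm_add_le _ _).trans (add_le_add hk ?_)
        rw [norm_smul, Real.norm_eq_abs]
    _ = |h| * ∑ j, ‖B k j‖ := by
        rw [← mul_add, Finset.sum_erase_add _ _ (Finset.mem_univ k)]
    _ ≤ |h| * ∑ i, ∑ j, ‖B i j‖ := by
        refine mul_le_mul_of_nonneg_left ?_ (abs_nonneg h)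
        exact Finset.single_le_sum (f := fun i => ∑ j, ‖B i j‖) (fun i _ => by positivity)
          (Finset.mem_univ k)

theorem isHermitian_diagonal_ofReal_add_smul {n : ℕ} (t : Fin n → ℝ)
    {B : Matrix (Fin n) (Fin n) ℂ} (hB : B.IsHermitian) (h : ℝ) :
    (Matrix.diagonal (fun i => (t i : ℂ)) + h • B).IsHermitian := by
  refine .add (Matrix.isHermitian_diagonal_of_self_adjoint _ ?_) (hB.smul ?_)
  · ext i
    simp
  · exact IsSelfAdjoint.all h

/-- The Taylor coefficient of order two of an operator convex function along a line through a
diagonal matrix is positive semidefinite. -/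
theorem OperatorConvexOfOrder.second_coeff_nonneg {n : ℕ} {s : Set ℝ} {f : ℝ → ℝ} (hs : IsOpen s)
    (hconv : OperatorConvexOfOrder n s f) {t : Fin n → ℝ} (ht : ∀ i, t i ∈ s) {p : ℝ[X]}
    (hp : ∀ i, (fun y => f y - p.eval y) =o[𝓝 (t i)] fun y => (y - t i) ^ 2)
    {d₁ : ℝ → ℝ → ℝ} {d₂ : ℝ → ℝ → ℝ → ℝ} (hd : p.HasDividedDiffs d₁ d₂)
    {B : Matrix (Fin n) (Fin n) ℂ} (hB : B.IsHermitian) (x : Fin n → ℂ) :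
    0 ≤ (star x ⬝ᵥ (Matrix.of fun i j =>
      ∑ k, (d₂ (t i) (t k) (t j) : ℂ) * (B i k * B k j)).mulVec x).re := by
  set A : ℝ → Matrix (Fin n) (Fin n) ℂ :=
    fun h => Matrix.diagonal (fun i => (t i : ℂ)) + h • B with hA
  set M := Matrix.of fun i j => ∑ k, (d₂ (t i) (t k) (t j) : ℂ) * (B i k * B k j)
  set K := ∑ i, ∑ j, ‖B i j‖
  set Φ : Matrix (Fin n) (Fin n) ℂ → ℝ := fun N => (star x ⬝ᵥ N.mulVec x).re with hΦ
  have hΦc : Continuous Φ := by fun_prop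
  have hAh : ∀ h, (A h).IsHermitian := isHermitian_diagonal_ofReal_add_smul t hB
  obtain ⟨R, hR, hexp⟩ := hd.expansion n t B
  -- The o-term becomes f ≤ p + η(y - tᵢ)² near tᵢ. Eigenvalues lie within |h|K of some tᵢ, so f(A
  -- h) ≤ p(A h) + ηK²h². An upper bound suffices, as f and p agree at the midpoint A 0.
  have key : ∀ η > 0, 0 ≤ Φ (M + (η * K ^ 2) • 1) := by
    intro η hη
    have hloc : ∀ i, ∃ ρ > 0, ∀ y, |y - t i| < ρ → y ∈ s ∧ f y ≤ p.eval y + η * (y - t i) ^ 2 := by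
      intro i
      have h1 := (hp i).bound hη
      obtain ⟨ρ, hρ, h2⟩ := Metric.eventually_nhds_iff.mp ((hs.eventually_mem (ht i)).and h1)
      refine ⟨ρ, hρ, fun y hy => ?_⟩
      obtain ⟨hys, hy'⟩ := h2 (y := y) (by rwa [Real.dist_eq])
      refine ⟨hys, ?_⟩
      have h3 := (le_abs_self _).trans hy'
      rw [norm_pow, Real.norm_eq_abs, sq_abs] at h3
      linarith
    choose ρ hρ hloc using hloc
    have hsmall : ∀ᶠ h : ℝ in 𝓝 0, ∀ i, |h| * K < ρ i := by
      refine eventually_all.mpr fun i => ?_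
      have : ContinuousAt (fun h : ℝ => |h| * K) 0 := by fun_prop
      exact this.eventually_lt_const (by simpa using hρ i)
    have hspec : ∀ h : ℝ, (∀ i, |h| * K < ρ i) → ∀ l ∈ spectrum ℝ (A h),
        l ∈ s ∧ f l ≤ p.eval l + η * K ^ 2 * h ^ 2 := by
      intro h hh l hl
      obtain ⟨k, hk⟩ := exists_abs_sub_le_of_mem_spectrum_diagonal_add t B hl
      obtain ⟨h1, h2⟩ := hloc k l (hk.trans_lt (hh k))
      refine ⟨h1, h2.trans ?_⟩
      have h3 : (l - t k) ^ 2 ≤ (|h| * K) ^ 2 := sq_le_sq' (by linarith [neg_abs_le (l - t k)])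
        ((le_abs_self _).trans hk)
      rw [mul_pow, sq_abs] at h3
      nlinarith
    have hcfc : ∀ h : ℝ, (∀ i, |h| * K < ρ i) →
        cfc f (A h) ≤ aeval (A h) p + (η * K ^ 2 * h ^ 2) • 1 := by
      intro h hh
      have hsa : IsSelfAdjoint (A h) := hAh h
      have hfin : (spectrum ℝ (A h)).Finite := Matrix.finite_real_spectrum
      calc cfc f (A h) ≤ cfc (p + C (η * K ^ 2 * h ^ 2)).eval (A h) :=
            cfc_mono (fun l hl => by simpa using (hspec h hh l hl).2) (hfin.continuousOn _)
              (hfin.continuousOn _)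
        _ = _ := by
            rw [cfc_polynomial _ _ hsa, map_add, aeval_C, Algebra.algebraMap_eq_smul_one]
    have hzero : cfc f (A 0) = aeval (A 0) p := by
      have hsa : IsSelfAdjoint (A 0) := hAh 0
      rw [← cfc_polynomial _ _ hsa]
      refine cfc_congr fun l hl => ?_
      obtain ⟨k, hk⟩ := exists_abs_sub_le_of_mem_spectrum_diagonal_add t B hl
      have : l = t k := by simpa [sub_eq_zero] using hk
      rw [this, isLittleO_sq_apply_eq (hp k)]
    have hev : ∀ᶠ h : ℝ in 𝓝[≠] 0,
        0 ≤ Φ (M + (η * K ^ 2) • 1 + (h / 2) • (R h - R (-h))) := by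
      filter_upwards [nhdsWithin_le_nhds hsmall, self_mem_nhdsWithin] with h hh hne
      have hh' : ∀ i, |-h| * K < ρ i := by simpa using hh
      have hc := hconv (A h) (A (-h)) (hAh h) (hAh (-h)) (fun l hl => (hspec h hh l hl).1)
        (fun l hl => (hspec (-h) hh' l hl).1) (1 / 2) ⟨by norm_num, by norm_num⟩
      have hmid : (1 / 2 : ℝ) • A h + (1 - 1 / 2 : ℝ) • A (-h) = A 0 := by
        simp only [hA]
        module
      rw [hmid, hzero] at hc
      have hc2 := hc.trans (add_le_add
        (smul_le_smul_of_nonneg_left (hcfc h hh) (by norm_num : (0 : ℝ) ≤ 1 / 2))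
        (smul_le_smul_of_nonneg_left (hcfc (-h) hh') (by norm_num : (0 : ℝ) ≤ 1 - 1 / 2)))
      have hpos := (Matrix.le_iff.mp hc2).dotProduct_mulVec_nonneg x
      -- Averaging over ±h cancels the linear terms; only the cubic remainders add to the h² term.
      have hre : 0 ≤ Φ ((h ^ 2) • (M + (η * K ^ 2) • 1 + (h / 2) • (R h - R (-h)))) := by
        refine (Complex.nonneg_iff.mp hpos).1.trans_eq (congrArg Φ ?_)
        rw [hexp h, hexp (-h), hexp 0]
        module
      have hsm : ∀ (c : ℝ) N, Φ (c • N) = c * Φ N := by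
        intro c N
        simp [hΦ, Matrix.smul_mulVec, dotProduct_smul]
      rw [hsm] at hre
      exact nonneg_of_mul_nonneg_right hre
        (sq_pos_of_ne_zero hne)
    have hlim : Tendsto (fun h : ℝ => Φ (M + (η * K ^ 2) • 1 + (h / 2) • (R h - R (-h))))
        (𝓝[≠] 0) (𝓝 (Φ (M + (η * K ^ 2) • 1))) := by
      have : Continuous fun h : ℝ => Φ (M + (η * K ^ 2) • 1 + (h / 2) • (R h - R (-h))) := by
        fun_prop
      have := this.tendsto 0
      simp only [zero_div, zero_smul, add_zero] at this
      exact this.mono_left nhdsWithin_le_nhds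
    exact ge_of_tendsto hlim hev
  have hlim : Tendsto (fun η : ℝ => Φ (M + (η * K ^ 2) • 1)) (𝓝[>] 0) (𝓝 (Φ M)) := by
    have : Continuous fun η : ℝ => Φ (M + (η * K ^ 2) • 1) := by fun_prop
    have := this.tendsto 0
    simp only [zero_mul, zero_smul, add_zero] at this
    exact this.mono_left nhdsWithin_le_nhds
  exact ge_of_tendsto hlim (eventually_mem_of_tendsto_nhdsWithin tendsto_id |>.mono key)

/-! ### Isolating one middle index -/

/-- The Hermitian matrix with entry `1` at `(i₀, i₀)`, entries `ε` elsewhere in the row and the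
column of `i₀`, and `0` everywhere else. -/
def crossMatrix {ι : Type*} [DecidableEq ι] (i₀ : ι) (ε : ℝ) : Matrix ι ι ℂ :=
  Matrix.of fun i j => if i = i₀ then (if j = i₀ then 1 else (ε : ℂ))
    else if j = i₀ then (ε : ℂ) else 0

theorem crossMatrix_isHermitian {ι : Type*} [DecidableEq ι] (i₀ : ι) (ε : ℝ) :
    (crossMatrix i₀ ε).IsHermitian := by
  ext i j
  simp only [crossMatrix, Matrix.conjTranspose_apply, Matrix.of_apply]
  split_ifs <;> simp

/-- Testing against a cross matrix isolates one term of the middle summation, up to an error of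
order `ε ^ 2`. -/
theorem crossMatrix_quadratic_form {ι : Type*} [Fintype ι] [DecidableEq ι] (i₀ : ι) {ε : ℝ}
    (hε : ε ≠ 0) (D : ι → ι → ι → ℂ) (ξ : ι → ℂ) :
    star (fun i => if i = i₀ then ξ i else ξ i / ε) ⬝ᵥ (Matrix.of fun i j =>
      ∑ k, D i k j * (crossMatrix i₀ ε i k * crossMatrix i₀ ε k j)).mulVec
        (fun i => if i = i₀ then ξ i else ξ i / ε) =
    star ξ ⬝ᵥ (Matrix.of fun i j => D i i₀ j).mulVec ξ
      + (ε : ℂ) ^ 2 * (∑ k ∈ Finset.univ.erase i₀, D i₀ k i₀) * (star (ξ i₀) * ξ i₀) := by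
  have hε' : (ε : ℂ) ≠ 0 := by exact_mod_cast hε
  have hcross : ∀ i, crossMatrix i₀ ε i₀ i * (if i = i₀ then ξ i else ξ i / ε) = ξ i := by
    intro i
    simp only [crossMatrix, Matrix.of_apply, if_true]
    split_ifs
    · simp
    · field_simp
  have hcross' : ∀ i, star (if i = i₀ then ξ i else ξ i / ε) * crossMatrix i₀ ε i i₀ =
      star (ξ i) := by
    intro i
    have := congrArg star (hcross i)
    rw [star_mul, ← (crossMatrix_isHermitian i₀ ε).apply i i₀] at *
    simpa using this
  -- For k ≠ i₀ only i = j = i₀ survives, where the test vector is not scaled by 1/ε, so the factor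
  -- ε² remains.
  have hoff : ∀ k ≠ i₀, ∀ i, crossMatrix i₀ ε i k = if i = i₀ then (ε : ℂ) else 0 := by
    intro k hk i
    simp [crossMatrix, hk]
  have hoff' : ∀ k ≠ i₀, ∀ i, crossMatrix i₀ ε k i = if i = i₀ then (ε : ℂ) else 0 := by
    intro k hk i
    simp [crossMatrix, hk]
  simp only [dotProduct, Matrix.mulVec, Matrix.of_apply, Pi.star_apply, Finset.sum_mul,
    Finset.mul_sum]
  simp_rw [fun i j => (Finset.add_sum_erase Finset.univ (fun k => star (if i = i₀ then ξ i else ξ i / ε)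
    * (D i k j * (crossMatrix i₀ ε i k * crossMatrix i₀ ε k j)
      * (if j = i₀ then ξ j else ξ j / ε))) (Finset.mem_univ i₀)).symm, Finset.sum_add_distrib]
  congr 1
  · refine Finset.sum_congr rfl fun i _ => Finset.sum_congr rfl fun j _ => ?_
    linear_combination (D i i₀ j * (crossMatrix i₀ ε i₀ j) *
      (if j = i₀ then ξ j else ξ j / ε)) * hcross' i + star (ξ i) * D i i₀ j * hcross j
  · rw [Finset.sum_comm' (t' := Finset.univ) (s' := fun _ => Finset.univ) (by simp)]
    simp_rw [Finset.sum_comm (t := Finset.univ.erase i₀)]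
    refine Finset.sum_congr rfl fun k hk => ?_
    have hk := Finset.ne_of_mem_erase hk
    simp only [hoff k hk, hoff' k hk]
    rw [Finset.sum_eq_single i₀ _ (by simp), Finset.sum_eq_single i₀ _ (by simp)]
    · simp
      ring
    · intro i _ hi
      simp [hi]
    · intro i _ hi
      simp [hi]

/-! ### The main theorem -/

theorem mainTheorem9 (n : ℕ) [NeZero n] (a b : EReal) (f : ℝ → ℝ)
    (hf : ContDiffOn ℝ 2 f (openInterval a b))
    (hconv : OperatorConvexOfOrder n (openInterval a b) f)
    (t : Fin n → ℝ) (ht : ∀ i, t i ∈ openInterval a b) :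
    (secondDividedDiffMatrix f t (t 0)).PosSemidef := by
  obtain ⟨p, hp⟩ := exists_polynomial_isLittleO_sq (isOpen_openInterval a b)
    (convex_openInterval a b) hf (Finset.univ.image t) (by
      rintro _ hx
      obtain ⟨i, -, rfl⟩ := Finset.mem_image.mp hx
      exact ht i)
  replace hp := fun i => hp (t i) (Finset.mem_image_of_mem t (Finset.mem_univ i))
  obtain ⟨d₁, d₂, hd⟩ := p.exists_hasDividedDiffs
  -- Symmetry moves `t 0` to the middle slot, that of the summation index in the expansion.
  have hmat : secondDividedDiffMatrix f t (t 0) =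
      Matrix.of fun i j => (d₂ (t i) (t 0) (t j) : ℂ) := by
    ext i j
    rw [secondDividedDiffMatrix, Matrix.of_apply, Matrix.of_apply,
      hd.secondDividedDiff_eq (hp i) (hp j) (hp 0), hd.second_swap_right]
  have hherm : (Matrix.of fun i j => (d₂ (t i) (t 0) (t j) : ℂ)).IsHermitian := by
    ext i j
    rw [Matrix.conjTranspose_apply, Matrix.of_apply, Matrix.of_apply, Complex.star_def,
      Complex.conj_ofReal, hd.second_swap_left, hd.second_swap_right, hd.second_swap_left]
  rw [hmat]
  refine .of_dotProduct_mulVec_nonneg hherm fun ξ => ?_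
  refine Complex.nonneg_iff.mpr ⟨?_, (hherm.im_star_dotProduct_mulVec_self ξ).symm⟩
  set S := star ξ ⬝ᵥ (Matrix.of fun i j => (d₂ (t i) (t 0) (t j) : ℂ)).mulVec ξ
  set E := (∑ k ∈ Finset.univ.erase 0, (d₂ (t 0) (t k) (t 0) : ℂ)) * (star (ξ 0) * ξ 0)
  have hpos : ∀ ε : ℝ, ε ≠ 0 → 0 ≤ (S + (ε : ℂ) ^ 2 * E).re := by
    intro ε hε
    have := hconv.second_coeff_nonneg (isOpen_openInterval a b) ht hp hd
      (crossMatrix_isHermitian 0 ε) (fun i => if i = 0 then ξ i else ξ i / ε)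
    rwa [crossMatrix_quadratic_form 0 hε (fun i k j => (d₂ (t i) (t k) (t j) : ℂ)), mul_assoc]
      at this
  have hlim : Tendsto (fun ε : ℝ => (S + (ε : ℂ) ^ 2 * E).re) (𝓝[≠] 0) (𝓝 S.re) := by
    have : Continuous fun ε : ℝ => (S + (ε : ℂ) ^ 2 * E).re := by fun_prop
    have := this.tendsto 0
    simp only [Complex.ofReal_zero, ne_eq, OfNat.ofNat_ne_zero, not_false_eq_true, zero_pow,
      zero_mul, add_zero] at this
    exact this.mono_left nhdsWithin_le_nhds
  exact ge_of_tendsto hlim (eventually_mem_nhdsWithin.mono hpos)
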